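/- Let $a=(a_j)_{j\ge 1}$ and $b=(b_j)_{j\ge1}$ be sequences of positive reals with $\inf_j a_j>0$, $\inf_j b_j>0$ and $a_1\le a_2\le\dots$, let $\omega\in(0,1)$ and $s\in\mathbb N=\{1,2,\dots\}$. For $h\in\mathbb Z^s$ put $\omega_h=\omega^{\sum_{j=1}^s a_j|h_j|^{b_j}}$ and let $H(K_s)$ be the Hilbert space of functions $[0,1]^s\to\mathbb C$ with reproducing kernel $$K_s(x,y)=\sum_{h\in\mathbb Z^s}\omega_h\exp\bigl(2\pi \mathrm i\,h\cdot(x-y)\bigr),\qquad x,y\in[0,1]^s .$$ Let $\lambda_{s,1}\ge\lambda_{s,2}\ge\dots$ be the eigenvalues, repeated according to multiplicity, of the operator $W_s:H(K_s)\to H(K_s)$, $W_sf=\int_{[0,1]^s}f(t)\,K_s(\cdot,t)\,\mathrm dt$. Let $\Lambda^{\rm all}$ be the class of all continuous linear functionals on $H(K_s)$ and $\Lambda^{\rm std}$ the class of all function evaluations $f\mapsto f(x)$ with $x\in[0,1]^s$. For $\Lambda\in\{\Lambda^{\rm all},\Lambda^{\rm std}\}$ let $$e^{L_\infty\text{-app},\Lambda}(n,s)=\inf_{\alpha_1,\dots,\alpha_n\in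 L_\infty([0,1]^s),\ L_1,\dots,L_n\in\Lambda}\ \ \sup_{\|f\|_{H(K_s)}\le 1}\Bigl\|f-\sum_{k=1}^n\alpha_kL_k(f)\Bigr\|_{L_\infty([0,1]^s)} .$$ Assume that there are numbers $\beta_s>0$ and $M_s>0$ such that $\lambda_{s,n}\le M_s^2\,n^{-2\beta_s}$ for all $n\in\mathbb N$. Then: 1. if $\beta_s>\tfrac12$, then for all $n\in\mathbb N$ $$e^{L_\infty\text{-app},\Lambda^{\rm all}}(n,s)\le\frac{M_s}{\sqrt{2\beta_s-1}}\,\frac1{n^{\beta_s-1/2}};$$ 2. if $\beta_s>\tfrac32$, then for all $n\in\mathbb N$ $$e^{L_\infty\text{-app},\Lambda^{\rm std}}(n,s)\le M_s\Bigl(\frac{\sqrt2}{2}+C(\beta_s)\Bigr)\frac1{n^{\beta_s-3/2}},$$ where $C(x)=2^{2x(2x+1)+x-1/2}\left(\frac{2x+1}{2x-1}\right)^{1/2}\left(1+\frac1{2x}\right)^x$. -/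

import Mathlib

open MeasureTheory
open scoped ENNReal

noncomputable section

namespace Korobov

/-- The unit cube `[0,1]^s`; its `volume` is the Lebesgue (product) measure. -/
abbrev Cube (s : ℕ) : Type := Fin s → unitInterval

/-- `ω_h = ω ^ (∑ j, a_j |h_j|^{b_j})` for `h ∈ ℤ^s`. The weight sequences are indexed from `0`:
`a j`, `b j` are the weights of the coordinate number `j + 1`. -/
def weight (a b : ℕ → ℝ) (ω : Set.Ioo (0 : ℝ) 1) {s : ℕ} (h : Fin s → ℤ) : ℝ :=
  (ω : ℝ) ^ (∑ j : Fin s, a j * |(h j : ℝ)| ^ b j)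

/-- `exp (2 π i h · x)`. -/
def character {s : ℕ} (h : Fin s → ℤ) (x : Fin s → ℝ) : ℂ :=
  Complex.exp (2 * Real.pi * Complex.I * ((∑ j, (h j : ℝ) * x j : ℝ) : ℂ))

/-- The reproducing kernel `K(x,y) = ∑_{h ∈ ℤ^s} ω_h exp (2 π i h · (x - y))`. -/
def kernel (a b : ℕ → ℝ) (ω : Set.Ioo (0 : ℝ) 1) {s : ℕ} (x y : Cube s) : ℂ :=
  ∑' h : Fin s → ℤ, (weight a b ω h : ℂ) * character h (fun j => (x j : ℝ) - (y j : ℝ))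

/-- The kernel in the operator-valued form that Mathlib uses: the scalar `K(x,y)` acts on `ℂ` by
multiplication. -/
def kernelMatrix (a b : ℕ → ℝ) (ω : Set.Ioo (0 : ℝ) 1) (s : ℕ) :
    Matrix (Cube s) (Cube s) (ℂ →L[ℂ] ℂ) :=
  Matrix.of fun x y => kernel a b ω x y • ContinuousLinearMap.id ℂ ℂ

lemma weight_nonneg (a b : ℕ → ℝ) (ω : Set.Ioo (0 : ℝ) 1) {s : ℕ} (h : Fin s → ℤ) :
    0 ≤ weight a b ω h := Real.rpow_nonneg ω.2.1.le _

lemma character_sub {s : ℕ} (h : Fin s → ℤ) (x y : Fin s → ℝ) :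
    character h (fun j => x j - y j) = character h x * star (character h y) := by
  have e : star (character h y)
      = Complex.exp (-(2 * Real.pi * Complex.I * ((∑ j, (h j : ℝ) * y j : ℝ) : ℂ))) := by
    rw [character, Complex.star_def, ← Complex.exp_conj]
    congr 1
    simp only [map_mul, Complex.conj_ofReal, Complex.conj_I, map_ofNat]
    ring
  rw [e, character, character, ← Complex.exp_add]
  congr 1
  simp only [mul_sub, Finset.sum_sub_distrib]
  push_cast
  ring

lemma norm_character {s : ℕ} (h : Fin s → ℤ) (x : Fin s → ℝ) : ‖character h x‖ = 1 := by
  have e : (2 * Real.pi * Complex.I * ((∑ j, (h j : ℝ) * x j : ℝ) : ℂ))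
      = ((2 * Real.pi * (∑ j, (h j : ℝ) * x j) : ℝ) : ℂ) * Complex.I := by
    push_cast
    ring
  rw [character, e, Complex.norm_exp_ofReal_mul_I]

lemma hasSum_kernel {a b : ℕ → ℝ} {ω : Set.Ioo (0 : ℝ) 1} {s : ℕ}
    (hs : Summable fun h : Fin s → ℤ => weight a b ω h) (x y : Cube s) :
    HasSum (fun h : Fin s → ℤ => (weight a b ω h : ℂ) *
      (character h (fun j => (x j : ℝ)) * star (character h (fun j => (y j : ℝ)))))
      (kernel a b ω x y) := by
  have : Summable fun h : Fin s → ℤ =>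
      (weight a b ω h : ℂ) * character h (fun j => (x j : ℝ) - (y j : ℝ)) := by
    refine Summable.of_norm ?_
    simpa [norm_character, abs_of_nonneg (weight_nonneg a b ω _)] using hs
  simpa only [kernel, character_sub] using this.hasSum

lemma kernel_eq_zero {a b : ℕ → ℝ} {ω : Set.Ioo (0 : ℝ) 1} {s : ℕ}
    (hs : ¬ Summable fun h : Fin s → ℤ => weight a b ω h) (x y : Cube s) :
    kernel a b ω x y = 0 := by
  refine tsum_eq_zero_of_not_summable fun h => hs ?_
  simpa [norm_character, abs_of_nonneg (weight_nonneg a b ω _)] using h.norm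

lemma star_kernel (a b : ℕ → ℝ) (ω : Set.Ioo (0 : ℝ) 1) {s : ℕ} (x y : Cube s) :
    star (kernel a b ω x y) = kernel a b ω y x := by
  by_cases hs : Summable fun h : Fin s → ℤ => weight a b ω h
  · refine HasSum.unique (f := fun h : Fin s → ℤ => (weight a b ω h : ℂ) *
      (character h (fun j => (y j : ℝ)) * star (character h (fun j => (x j : ℝ))))) ?_
      (hasSum_kernel hs y x)
    convert (hasSum_kernel hs x y).star using 2
    rw [star_mul', star_mul', star_star, Complex.star_def, Complex.conj_ofReal,
      mul_comm (character _ _)]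
  · simp [kernel_eq_zero hs]

/-- The kernel is positive semidefinite. -/
theorem posSemidef_kernelMatrix (a b : ℕ → ℝ) (ω : Set.Ioo (0 : ℝ) 1) (s : ℕ) :
    (kernelMatrix a b ω s).PosSemidef := by
  refine ((RKHS.posSemidef_tfae (K := kernelMatrix a b ω s)).out 0 2 rfl rfl).mpr
    ⟨?_, fun v => ?_⟩
  · ext x y
    simp [kernelMatrix, Matrix.conjTranspose_apply, ← star_kernel a b ω x y,
      ContinuousLinearMap.star_eq_adjoint, ContinuousLinearMap.adjoint_id]
  · by_cases hs : Summable fun h : Fin s → ℤ => weight a b ω h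
    · have key : HasSum (fun h : Fin s → ℤ => (weight a b ω h : ℂ) *
          (star (∑ x ∈ v.support, star (character h (fun j => (x j : ℝ))) * v x) *
            (∑ x ∈ v.support, star (character h (fun j => (x j : ℝ))) * v x)))
          (v.sum fun x w => v.sum fun x' w' => inner ℂ (kernelMatrix a b ω s x' x w) w') := by
        have h1 := hasSum_sum (s := v.support) fun x _ => hasSum_sum (s := v.support) fun x' _ =>
          ((hasSum_kernel hs x' x).star.mul_right (star (v x) * v x'))
        have hl : (v.sum fun x w => v.sum fun x' w' => inner ℂ (kernelMatrix a b ω s x' x w) w')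
            = ∑ x ∈ v.support, ∑ x' ∈ v.support,
              star (kernel a b ω x' x) * (star (v x) * v x') := by
          simp only [Finsupp.sum]
          refine Finset.sum_congr rfl fun x _ => Finset.sum_congr rfl fun x' _ => ?_
          simp [kernelMatrix]
          ring
        rw [hl]
        refine h1.congr_fun fun h => ?_
        rw [star_sum, Finset.sum_mul_sum, Finset.mul_sum]
        refine Finset.sum_congr rfl fun x _ => ?_
        rw [Finset.mul_sum]
        refine Finset.sum_congr rfl fun x' _ => ?_
        simp
        ring
      refine (Complex.hasSum_re key).nonneg fun h => ?_
      rw [Complex.star_def, ← Complex.normSq_eq_conj_mul_self, ← Complex.ofReal_mul,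
        Complex.ofReal_re]
      exact mul_nonneg (weight_nonneg a b ω h) (Complex.normSq_nonneg _)
    · simp [kernelMatrix, kernel_eq_zero hs, Finsupp.sum]

instance instFactPosSemidef (a b : ℕ → ℝ) (ω : Set.Ioo (0 : ℝ) 1) (s : ℕ) :
    Fact (kernelMatrix a b ω s).PosSemidef := ⟨posSemidef_kernelMatrix a b ω s⟩

/-- The Korobov space `H(K)`: the Hilbert space of functions `[0,1]^s → ℂ` with reproducing
kernel `K`. -/
abbrev Space (a b : ℕ → ℝ) (ω : Set.Ioo (0 : ℝ) 1) (s : ℕ) : Type :=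
  RKHS.OfKernel (kernelMatrix a b ω s)

/-- The function `W f = ∫_{[0,1]^s} f(t) K(·,t) dt`, where `W = EMB* EMB` for the embedding `EMB` of
`H(K)` into `L₂([0,1]^s)`. -/
def covariance (a b : ℕ → ℝ) (ω : Set.Ioo (0 : ℝ) 1) {s : ℕ} (f : Space a b ω s) :
    Cube s → ℂ :=
  fun x => ∫ t : Cube s, f t * kernel a b ω x t

/-- The span of all `f ∈ H(K)` with `W f = μ f` for some real `μ ≥ t`. -/
def eigenspaceGE (a b : ℕ → ℝ) (ω : Set.Ioo (0 : ℝ) 1) (s : ℕ) (t : ℝ) :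
    Submodule ℂ (Space a b ω s) :=
  Submodule.span ℂ {f | ∃ μ : ℝ, t ≤ μ ∧ ∀ x, covariance a b ω f x = (μ : ℂ) * f x}

/-- `λ_{s,n}`, `n ≥ 1`: the `n`-th largest eigenvalue of `W`, counted with multiplicity, i.e. the
largest `t > 0` for which the eigenfunctions to eigenvalues `≥ t` span a space of dimension at
least `n`. -/
def eigenvalue (a b : ℕ → ℝ) (ω : Set.Ioo (0 : ℝ) 1) (s n : ℕ) : ℝ :=
  sSup {t : ℝ | 0 < t ∧ (n : Cardinal) ≤ Module.rank ℂ (eigenspaceGE a b ω s t)}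

/-- `Λ^all`: all continuous linear functionals on `H(K)`. -/
def LambdaAll (a b : ℕ → ℝ) (ω : Set.Ioo (0 : ℝ) 1) (s : ℕ) : Set (Space a b ω s →L[ℂ] ℂ) :=
  Set.univ

/-- `Λ^std`: the function evaluations at points of `[0,1]^s`. -/
def LambdaStd (a b : ℕ → ℝ) (ω : Set.Ioo (0 : ℝ) 1) (s : ℕ) : Set (Space a b ω s →L[ℂ] ℂ) :=
  {L | ∃ x : Cube s, ∀ f : Space a b ω s, L f = f x}

/-- The worst-case `L_∞` error, over the unit ball of `H(K)`, of the linear algorithm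
`A f = ∑ k, L_k(f) α_k`. -/
def worstCaseError {a b : ℕ → ℝ} {ω : Set.Ioo (0 : ℝ) 1} {s n : ℕ}
    (α : Fin n → Lp ℂ ∞ (volume : Measure (Cube s))) (L : Fin n → Space a b ω s →L[ℂ] ℂ) : ℝ≥0∞ :=
  ⨆ (f : Space a b ω s) (_ : ‖f‖ ≤ 1),
    eLpNorm (fun x : Cube s => f x - ∑ k, α k x * L k f) ∞ volume

/-- The `n`-th minimal worst-case `L_∞` error `e^{L_∞-app,Λ}(n,s)`: the infimum over all linear
algorithms that use `n` functionals from `Λ`. -/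
def minimalError {a b : ℕ → ℝ} {ω : Set.Ioo (0 : ℝ) 1} {s : ℕ}
    (Λ : Set (Space a b ω s →L[ℂ] ℂ)) (n : ℕ) : ℝ≥0∞ :=
  ⨅ (α : Fin n → Lp ℂ ∞ (volume : Measure (Cube s))) (L : Fin n → Space a b ω s →L[ℂ] ℂ)
    (_ : ∀ k, L k ∈ Λ), worstCaseError α L

/-- `C(x) = 2^{2x(2x+1)+x-1/2} ((2x+1)/(2x-1))^{1/2} (1+1/(2x))^x`. -/
def C (x : ℝ) : ℝ :=
  (2 : ℝ) ^ (2 * x * (2 * x + 1) + x - 1 / 2) * ((2 * x + 1) / (2 * x - 1)) ^ (1 / 2 : ℝ)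
    * (1 + 1 / (2 * x)) ^ x

end Korobov

end

noncomputable section

namespace Korobov

open Filter Topology

/-! ### Summability and decreasing enumeration of the weights. -/

section Summation

/-! The functions `√ω_h · exp (2πi h·x)` are orthonormal in `H(K)` and are eigenfunctions of `W`
with eigenvalues `ω_h`. The weights are summable, so they can be listed in decreasing order;
`weight_le_eigenvalue` then bounds the term of index `n` (from `0`) by `λ_{s,n+1}`, and the assumed
decay applies to it.

For arbitrary functionals, project onto the first `n` basis vectors. By Cauchy–Schwarz with the
kernel section, the squared error at every point is at most the tail of the weights, and an integral
comparison bounds that tail by `M² / ((2β-1) n^{2β-1})`.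

For function values, interpolate in the span of the same `n` vectors at Fekete points, which
maximise the modulus of the interpolation determinant. The Lagrange functions are then bounded by
`1` (`exists_lagrange_le_one`), so interpolation costs at most a factor `1 + n` over the projection
error. This loses one power of `n`, and the constant obtained is below the claimed one because `C β
≥ 1`. -/

lemma summable_pi_prod_of_nonneg {ι : Type*} : ∀ {n : ℕ} (f : Fin n → ι → ℝ),
    (∀ j i, 0 ≤ f j i) → (∀ j, Summable (f j)) →
    Summable fun h : Fin n → ι => ∏ j, f j (h j)
  | 0, _, _, _ => (hasSum_fintype _).summable
  | n + 1, f, h0, hf => by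
    have ih := summable_pi_prod_of_nonneg (fun j : Fin n => f j.succ) (fun j => h0 _)
      (fun j => hf _)
    have h1 := (hf 0).mul_of_nonneg ih (h0 0)
      (fun h => Finset.prod_nonneg fun j _ => h0 _ _)
    rw [← (Fin.consEquiv fun _ : Fin (n + 1) => ι).summable_iff]
    refine h1.congr fun p => ?_
    simp [Fin.prod_univ_succ, Fin.consEquiv]

lemma summable_rpow_abs_rpow {q c d : ℝ} (hq0 : 0 < q) (hq1 : q < 1) (hc : 0 < c) (hd : 0 < d) :
    Summable fun k : ℤ => q ^ (c * |(k : ℝ)| ^ d) := by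
  have key : Summable fun k : ℕ => q ^ (c * (k : ℝ) ^ d) := by
    have hl : 0 < -Real.log q * c := mul_pos (neg_pos.2 (Real.log_neg hq0 hq1)) hc
    -- Exponential decay in `k^d` beats every power of `k^d`; the exponent `-2/d` is chosen so that
    -- the comparison series is `k^{-2}`.
    have ho := (isLittleO_exp_neg_mul_rpow_atTop hl (-(2 / d))).comp_tendsto
      ((tendsto_rpow_atTop hd).comp tendsto_natCast_atTop_atTop)
    refine summable_of_isBigO_nat (Real.summable_nat_rpow.2 (by norm_num : (-2 : ℝ) < -1)) ?_
    refine (ho.isBigO.congr_left fun k => ?_).congr_right fun k => ?_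
    · simp only [Function.comp_apply]
      rw [Real.rpow_def_of_pos hq0]
      congr 1
      ring
    · simp only [Function.comp_apply]
      rw [← Real.rpow_mul (Nat.cast_nonneg k)]
      congr 1
      field_simp
  refine Summable.of_nat_of_neg ?_ ?_ <;> simpa using key

lemma sum_range_one_div_rpow_le {p : ℝ} (hp : 1 < p) {n : ℕ} (hn : 1 ≤ n) (N : ℕ) :
    ∑ i ∈ Finset.range N, 1 / ((n + i + 1 : ℕ) : ℝ) ^ p ≤
      1 / ((p - 1) * (n : ℝ) ^ (p - 1)) := by
  have hn0 : (0 : ℝ) < n := by exact_mod_cast hn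
  have hanti : AntitoneOn (fun x : ℝ => x ^ (-p)) (Set.Icc (n : ℝ) (n + N)) := fun x hx y _ hxy =>
    Real.rpow_le_rpow_of_nonpos (hn0.trans_le hx.1) hxy (by linarith)
  have h1 := hanti.sum_le_integral
  have hle : (n : ℝ) ≤ n + N := by simp
  rw [integral_rpow (Or.inr ⟨by linarith, by
    rw [Set.uIcc_of_le hle]; exact fun h => absurd h.1 (not_le.2 hn0)⟩)] at h1
  have h2 : ∑ i ∈ Finset.range N, 1 / ((n + i + 1 : ℕ) : ℝ) ^ p =
      ∑ i ∈ Finset.range N, ((n : ℝ) + ((i + 1 : ℕ) : ℝ)) ^ (-p) := by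
    refine Finset.sum_congr rfl fun i _ => ?_
    rw [Real.rpow_neg (by positivity), one_div]
    push_cast
    ring_nf
  rw [h2]
  refine h1.trans ?_
  have h3 : 0 ≤ ((n : ℝ) + N) ^ (-p + 1) := by positivity
  have h4 : 1 / ((p - 1) * (n : ℝ) ^ (p - 1)) = (n : ℝ) ^ (-p + 1) / (p - 1) := by
    rw [show -p + 1 = -(p - 1) by ring, Real.rpow_neg hn0.le]
    field_simp
  rw [h4, show -p + 1 = -(p - 1) by ring, div_neg, ← neg_div]
  rw [show -p + 1 = -(p - 1) by ring] at h3
  exact div_le_div_of_nonneg_right (by linarith) (by linarith)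

/-- A positive summable family on an infinite type can be enumerated in decreasing order. -/
lemma exists_equiv_nat_antitone {ι : Type*} [Infinite ι] {w : ι → ℝ} (hw : ∀ i, 0 < w i)
    (hs : Summable w) : ∃ e : ℕ ≃ ι, Antitone fun k => w (e k) := by
  classical
  have htend := hs.tendsto_cofinite_zero
  have hfin (i : ι) : {j | w i ≤ w j}.Finite := by
    have := htend.eventually (gt_mem_nhds (hw i))
    rw [eventually_cofinite] at this
    simpa using this
  have hmax (F : Finset ι) : ∃ i ∉ F, ∀ j ∉ F, w j ≤ w i := by
    obtain ⟨i₀, hi₀⟩ := Infinite.exists_notMem_finset F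
    have hf : ({j | w i₀ ≤ w j} \ (F : Set ι)).Finite := (hfin i₀).sdiff
    obtain ⟨i, hi, him⟩ := Set.exists_max_image _ w hf ⟨i₀, by simp, by simpa using hi₀⟩
    refine ⟨i, by simpa using hi.2, fun j hj => ?_⟩
    by_cases h : w i₀ ≤ w j
    · exact him j ⟨h, by simpa using hj⟩
    · exact (not_le.1 h).le.trans hi.1
  choose c hc hcm using hmax
  -- Greedy choice: `S n` holds the first `n` indices picked, and `c (S n)` is one of largest weight
  -- among the rest.
  let S : ℕ → Finset ι := fun n => Nat.rec ∅ (fun _ F => insert (c F) F) n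
  have hS (n) : S (n + 1) = insert (c (S n)) (S n) := rfl
  have hmono : Monotone S := monotone_nat_of_le_succ fun n => by
    rw [hS]; exact Finset.subset_insert _ _
  have hmem {m n : ℕ} (h : m < n) : c (S m) ∈ S n :=
    hmono (Nat.succ_le_of_lt h) (by rw [hS]; exact Finset.mem_insert_self _ _)
  have hinj : Function.Injective fun n => c (S n) := by
    intro m n h
    simp only at h
    rcases lt_trichotomy m n with h' | h' | h'
    · exact absurd (h ▸ hmem h') (hc _)
    · exact h'
    · exact absurd (h ▸ hmem h') (hc _)
  have hsurj : Function.Surjective fun n => c (S n) := by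
    intro i
    by_contra hi
    have hnot (n) : i ∉ S n := by
      induction n with
      | zero => simp [S]
      | succ n ih =>
        rw [hS, Finset.mem_insert, not_or]
        exact ⟨fun h => hi ⟨n, h.symm⟩, ih⟩
    -- An index never picked would be outweighed, weakly, by infinitely many picked ones, against
    -- summability.
    exact Set.infinite_of_injective_forall_mem hinj (fun n => hcm (S n) i (hnot n)) (hfin i)
  exact ⟨Equiv.ofBijective _ ⟨hinj, hsurj⟩, antitone_nat_of_succ_le fun n =>
    hcm _ _ fun h => hc _ (hmono n.le_succ h)⟩

end Summation

/-! ### Interpolation at Fekete points. -/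

section Interpolation

variable {X : Type*}

/-- A functional vanishing on all vectors `(g i x)_i` is a linear relation among the `g i`. Hence
these vectors span `ℂⁿ`, and `n` of them form a basis. -/
lemma exists_det_eval_ne_zero {n : ℕ} {g : Fin n → X → ℂ} (hg : LinearIndependent ℂ g) :
    ∃ p : Fin n → X, (Matrix.of fun i j => g i (p j)).det ≠ 0 := by
  classical
  let v : X → Fin n → ℂ := fun x i => g i x
  have hspan : Submodule.span ℂ (Set.range v) = ⊤ := by
    by_contra hne
    obtain ⟨φ, hφ, hle⟩ := Submodule.exists_le_ker_of_lt_top _ (lt_top_iff_ne_top.2 hne)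
    refine hφ ?_
    have hsum : ∑ i, φ (Pi.single i 1) • g i = 0 := by
      ext x
      have h1 : φ (v x) = 0 := hle (Submodule.subset_span ⟨x, rfl⟩)
      rw [pi_eq_sum_univ (v x), map_sum] at h1
      simp only [map_smul, smul_eq_mul] at h1
      simp only [Finset.sum_apply, Pi.smul_apply, smul_eq_mul, Pi.zero_apply]
      rw [← h1]
      refine Finset.sum_congr rfl fun i _ => ?_
      rw [mul_comm]
      congr 2
      ext j
      simp [Pi.single_apply, eq_comm]
    have h2 := Fintype.linearIndependent_iff.1 hg _ hsum
    refine LinearMap.pi_ext fun i z => ?_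
    have : (Pi.single i z : Fin n → ℂ) = z • Pi.single i 1 := by
      rw [← Pi.single_smul]; simp
    rw [this, map_smul, h2 i]
    simp
  obtain ⟨κ, a, ha, hsp, hli⟩ := exists_linearIndependent' ℂ v
  rw [hspan] at hsp
  let B : Module.Basis κ ℂ (Fin n → ℂ) := Module.Basis.mk hli hsp.ge
  let e : κ ≃ Fin n := B.indexEquiv (Pi.basisFun ℂ (Fin n))
  refine ⟨fun j => a (e.symm j), ?_⟩
  have hli' : LinearIndependent ℂ fun j : Fin n => (v ∘ a) (e.symm j) :=
    hli.comp _ e.symm.injective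
  have : IsUnit (Matrix.of fun i j => g i (a (e.symm j))) := by
    rw [← Matrix.linearIndependent_cols_iff_isUnit]
    exact hli'
  exact ((Matrix.isUnit_iff_isUnit_det _).1 this).ne_zero

/-- Interpolation at Fekete points: the Lagrange functions are bounded by `1`. -/
lemma exists_lagrange_le_one [TopologicalSpace X] [CompactSpace X] {n : ℕ} {g : Fin n → X → ℂ}
    (hg : LinearIndependent ℂ g) (hc : ∀ i, Continuous (g i)) :
    ∃ (p : Fin n → X) (l : Fin n → X → ℂ), (∀ j, Continuous (l j)) ∧ (∀ j x, ‖l j x‖ ≤ 1) ∧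
      ∀ i x, ∑ j, l j x * g i (p j) = g i x := by
  classical
  obtain ⟨p₀, hp₀⟩ := exists_det_eval_ne_zero hg
  let D : (Fin n → X) → ℂ := fun p => (Matrix.of fun i j => g i (p j)).det
  have hD : Continuous D := by
    refine Continuous.matrix_det (continuous_matrix fun i j => ?_)
    exact (hc i).comp (continuous_apply j)
  obtain ⟨p, -, hp⟩ := isCompact_univ.exists_isMaxOn ⟨p₀, Set.mem_univ _⟩ hD.norm.continuousOn
  have hpD : ∀ q, ‖D q‖ ≤ ‖D p‖ := fun q => hp (Set.mem_univ q)
  have hne : D p ≠ 0 := norm_pos_iff.1 ((norm_pos_iff.2 hp₀).trans_le (hpD p₀))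
  -- The Lagrange function is the determinant with the `j`-th node moved to `x`, divided by the
  -- maximal determinant, so its modulus is at most `1`; Cramer's rule gives the reproduction
  -- identity.
  refine ⟨p, fun j x => D (Function.update p j x) / D p, fun j => ?_, fun j x => ?_, fun i x => ?_⟩
  · exact (hD.comp (continuous_const.update j continuous_id)).div_const _
  · rw [norm_div]
    exact div_le_one_of_le₀ (hpD _) (norm_nonneg _)
  · have hcr (j) : D (Function.update p j x) =
        (Matrix.of fun i j => g i (p j)).cramer (fun i => g i x) j := by
      rw [Matrix.cramer_apply]
      simp only [D]
      congr 1
      ext i k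
      by_cases h : k = j
      · subst h; simp
      · simp [h]
    have := congrFun (Matrix.mulVec_cramer (Matrix.of fun i j => g i (p j)) fun i => g i x) i
    simp only [Matrix.mulVec, dotProduct, Matrix.of_apply, Pi.smul_apply, smul_eq_mul] at this
    simp only [hcr]
    rw [eq_comm, ← mul_right_inj' hne]
    refine this.symm.trans ?_
    rw [Finset.mul_sum]
    refine Finset.sum_congr rfl fun j _ => ?_
    field_simp

end Interpolation

lemma norm_sq_sub_sum_inner {E ι : Type*} [NormedAddCommGroup E] [InnerProductSpace ℂ E]
    {u : ι → E} (hu : Orthonormal ℂ u) (F : Finset ι) (k : E) :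
    ‖k - ∑ i ∈ F, inner ℂ (u i) k • u i‖ ^ 2 = ‖k‖ ^ 2 - ∑ i ∈ F, ‖inner ℂ (u i) k‖ ^ 2 := by
  have h0 : inner ℂ (k - ∑ i ∈ F, inner ℂ (u i) k • u i) (∑ i ∈ F, inner ℂ (u i) k • u i) = 0 := by
    rw [inner_sum]
    refine Finset.sum_eq_zero fun i hi => ?_
    rw [inner_smul_right, inner_sub_left, hu.inner_left_sum _ hi]
    simp
  have h1 : ‖∑ i ∈ F, inner ℂ (u i) k • u i‖ ^ 2 = ∑ i ∈ F, ‖inner ℂ (u i) k‖ ^ 2 := by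
    rw [@norm_sq_eq_re_inner ℂ, hu.inner_sum, map_sum]
    refine Finset.sum_congr rfl fun i _ => ?_
    rw [RCLike.conj_mul]
    norm_cast
  have h2 := norm_add_sq_eq_norm_sq_add_norm_sq_of_inner_eq_zero _ _ h0
  rw [sub_add_cancel] at h2
  rw [← h1]
  nlinarith [h2]

/-! ### Weights and characters. -/

variable {a b : ℕ → ℝ} {ω : Set.Ioo (0 : ℝ) 1} {s : ℕ}

lemma weight_pos (a b : ℕ → ℝ) (ω : Set.Ioo (0 : ℝ) 1) (h : Fin s → ℤ) :
    0 < weight a b ω h := Real.rpow_pos_of_pos ω.2.1 _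

lemma summable_weight (ha : ∀ j, 0 < a j) (hb : ∀ j, 0 < b j) :
    Summable fun h : Fin s → ℤ => weight a b ω h := by
  refine (summable_pi_prod_of_nonneg (fun (j : Fin s) (k : ℤ) => (ω : ℝ) ^ (a j * |(k : ℝ)| ^ b j))
    (fun _ _ => Real.rpow_nonneg ω.2.1.le _)
    (fun j => summable_rpow_abs_rpow ω.2.1 ω.2.2 (ha j) (hb j))).congr fun h => ?_
  rw [weight, Real.rpow_sum_of_pos ω.2.1]

/-- The character `x ↦ exp (2 π i h · x)` on the cube. -/
def cubeChar (h : Fin s → ℤ) (x : Cube s) : ℂ := character h fun j => (x j : ℝ)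

@[fun_prop]
lemma continuous_cubeChar (h : Fin s → ℤ) : Continuous (cubeChar h) := by
  unfold cubeChar character
  fun_prop

@[simp]
lemma norm_cubeChar (h : Fin s → ℤ) (x : Cube s) : ‖cubeChar h x‖ = 1 := norm_character _ _

lemma character_eq_prod (h : Fin s → ℤ) (x : Fin s → ℝ) :
    character h x = ∏ j, Complex.exp (2 * Real.pi * Complex.I * h j * x j) := by
  rw [character, ← Complex.exp_sum]
  congr 1
  push_cast
  rw [Finset.mul_sum]
  exact Finset.sum_congr rfl fun _ _ => by ring

lemma integral_exp_unitInterval (k : ℤ) :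
    ∫ t : unitInterval, Complex.exp (2 * Real.pi * Complex.I * k * (t : ℝ)) =
      if k = 0 then 1 else 0 := by
  have h1 : ∫ t : unitInterval, Complex.exp (2 * Real.pi * Complex.I * k * (t : ℝ)) =
      ∫ t in (0 : ℝ)..1, Complex.exp (2 * Real.pi * Complex.I * k * t) := by
    rw [intervalIntegral.integral_of_le zero_le_one, ← integral_Icc_eq_integral_Ioc]
    exact integral_subtype measurableSet_Icc
      fun t : ℝ => Complex.exp (2 * Real.pi * Complex.I * k * t)
  rw [h1]
  split_ifs with hk
  · simp [hk]
  · have hc : 2 * Real.pi * Complex.I * k ≠ 0 := by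
      simp [hk, Real.pi_ne_zero]
    rw [integral_exp_mul_complex hc]
    have : Complex.exp (2 * Real.pi * Complex.I * k * (1 : ℝ)) = 1 := by
      rw [Complex.exp_eq_one_iff]
      exact ⟨k, by push_cast; ring⟩
    rw [this]
    simp

lemma integral_star_cubeChar_mul (g h : Fin s → ℤ) :
    ∫ x : Cube s, star (cubeChar g x) * cubeChar h x = if g = h then 1 else 0 := by
  have h1 (x : Cube s) : star (cubeChar g x) * cubeChar h x =
      ∏ j, Complex.exp (2 * Real.pi * Complex.I * (h j - g j : ℤ) * (x j : ℝ)) := by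
    rw [cubeChar, cubeChar, character_eq_prod, character_eq_prod, star_prod,
      ← Finset.prod_mul_distrib]
    refine Finset.prod_congr rfl fun j _ => ?_
    rw [Complex.star_def, ← Complex.exp_conj, ← Complex.exp_add]
    congr 1
    simp only [map_mul, Complex.conj_ofReal, Complex.conj_I, map_ofNat, map_intCast]
    push_cast
    ring
  simp only [h1]
  rw [integral_fintype_prod_volume_eq_prod (fun (j : Fin s) (t : unitInterval) =>
    Complex.exp (2 * Real.pi * Complex.I * (h j - g j : ℤ) * (t : ℝ)))]
  simp only [integral_exp_unitInterval, sub_eq_zero, Finset.prod_ite_zero, Finset.prod_const_one]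
  simp only [funext_iff, Finset.mem_univ, true_imp_iff, eq_comm]

/-! ### The kernel, its sections and the orthonormal basis vectors. -/

lemma continuous_kernel (hs : Summable fun h : Fin s → ℤ => weight a b ω h) :
    Continuous fun p : Cube s × Cube s => kernel a b ω p.1 p.2 := by
  unfold kernel
  refine continuous_tsum (fun h => ?_) hs fun h p => ?_
  · unfold character
    fun_prop
  · simp [norm_character, abs_of_nonneg (weight_nonneg a b ω h)]

lemma norm_kernel_le (hs : Summable fun h : Fin s → ℤ => weight a b ω h) (x y : Cube s) :
    ‖kernel a b ω x y‖ ≤ ∑' h : Fin s → ℤ, weight a b ω h :=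
  tsum_of_norm_bounded hs.hasSum fun h => by
    simp [norm_character, abs_of_nonneg (weight_nonneg a b ω h)]

lemma integral_cubeChar_mul_kernel (hs : Summable fun h : Fin s → ℤ => weight a b ω h)
    (h : Fin s → ℤ) (x : Cube s) :
    ∫ t, cubeChar h t * kernel a b ω x t = weight a b ω h * cubeChar h x := by
  classical
  let F : (Fin s → ℤ) → Cube s → ℂ := fun g t =>
    cubeChar h t * ((weight a b ω g : ℂ) * (cubeChar g x * star (cubeChar g t)))
  have hFc (g) : Continuous (F g) := by fun_prop
  have hFn (g t) : ‖F g t‖ = weight a b ω g := by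
    simp [F, abs_of_nonneg (weight_nonneg a b ω g)]
  have h1 : HasSum (fun g => ∫ t, F g t) (∫ t, ∑' g, F g t) := by
    refine hasSum_integral_of_summable_integral_norm (fun g => ?_) ?_
    · exact Integrable.of_bound (hFc g).aestronglyMeasurable (weight a b ω g)
        (ae_of_all _ fun t => (hFn g t).le)
    · simpa [hFn] using hs
  have h2 (t) : ∑' g, F g t = cubeChar h t * kernel a b ω x t :=
    ((hasSum_kernel hs x t).mul_left _).tsum_eq
  have h3 (g) : ∫ t, F g t = if g = h then (weight a b ω h : ℂ) * cubeChar h x else 0 := by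
    have : ∀ t, F g t = (weight a b ω g * cubeChar g x) * (star (cubeChar g t) * cubeChar h t) :=
      fun t => by simp only [F]; ring
    simp only [this]
    rw [integral_const_mul, integral_star_cubeChar_mul]
    split_ifs with hg <;> simp [hg]
  simp only [h2, h3] at h1
  exact h1.unique (hasSum_ite_eq h _)

/-- The kernel section `K(·, x)`. -/
def kernelSection (a b : ℕ → ℝ) (ω : Set.Ioo (0 : ℝ) 1) (x : Cube s) : Space a b ω s :=
  RKHS.kerFun (Space a b ω s) x (1 : ℂ)

lemma inner_kernelSection (x : Cube s) (f : Space a b ω s) :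
    inner ℂ (kernelSection a b ω x) f = f x := by
  rw [kernelSection, RKHS.kerFun_inner]
  simp

lemma inner_kernelSection_right (x : Cube s) (f : Space a b ω s) :
    inner ℂ f (kernelSection a b ω x) = star (f x) := by
  rw [← inner_conj_symm, inner_kernelSection]
  rfl

lemma kernelSection_apply (x y : Cube s) : kernelSection a b ω y x = kernel a b ω x y := by
  rw [kernelSection, RKHS.kerFun_apply, RKHS.OfKernel.kernel_ofKernel]
  simp [kernelMatrix]

lemma norm_kernelSection_sq (x : Cube s) :
    ‖kernelSection a b ω x‖ ^ 2 = ∑' h : Fin s → ℤ, weight a b ω h := by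
  rw [@norm_sq_eq_re_inner ℂ, inner_kernelSection, kernelSection_apply]
  simp [kernel, character, ← Complex.ofReal_tsum]

lemma continuous_kernelSection (hs : Summable fun h : Fin s → ℤ => weight a b ω h) :
    Continuous (kernelSection (s := s) a b ω) := by
  refine continuous_iff_continuousAt.2 fun x => tendsto_iff_norm_sub_tendsto_zero.2 ?_
  have h1 (y) : ‖kernelSection a b ω y - kernelSection a b ω x‖ = √(
      2 * ∑' h : Fin s → ℤ, weight a b ω h - 2 * (kernel a b ω y x).re) := by
    rw [← Real.sqrt_sq (norm_nonneg (_ - _)), @norm_sub_sq ℂ, norm_kernelSection_sq,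
      norm_kernelSection_sq, inner_kernelSection, kernelSection_apply, RCLike.re_eq_complex_re]
    congr 1
    ring
  have h2 : Continuous fun y => ‖kernelSection a b ω y - kernelSection a b ω x‖ := by
    simp only [h1]
    have := (continuous_kernel hs).comp (Continuous.prodMk_left x)
    simp only [Function.comp_def] at this
    fun_prop
  simpa using h2.tendsto x

lemma Space.continuous (hs : Summable fun h : Fin s → ℤ => weight a b ω h) (f : Space a b ω s) :
    Continuous f := by
  have : Continuous fun x => inner ℂ (kernelSection a b ω x) f :=
    (continuous_kernelSection hs).inner continuous_const
  simpa only [inner_kernelSection] using this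

/-- The element of `H(K)` represented by `√ω_h exp (2 π i h · x)`. -/
def basisVec (a b : ℕ → ℝ) (ω : Set.Ioo (0 : ℝ) 1) (h : Fin s → ℤ) : Space a b ω s :=
  ((√(weight a b ω h))⁻¹ : ℂ) • ∫ t, cubeChar h t • kernelSection a b ω t

lemma integrable_cubeChar_smul_kernelSection
    (hs : Summable fun h : Fin s → ℤ => weight a b ω h) (h : Fin s → ℤ) :
    Integrable fun t => cubeChar h t • kernelSection a b ω t :=
  ((continuous_cubeChar h).smul (continuous_kernelSection hs)).integrable_of_hasCompactSupport
    (HasCompactSupport.of_compactSpace _)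

lemma sqrt_weight_inv_mul (h : Fin s → ℤ) :
    ((√(weight a b ω h))⁻¹ : ℂ) * (weight a b ω h : ℂ) = (√(weight a b ω h) : ℂ) := by
  have h1 : √(weight a b ω h) ≠ 0 := (Real.sqrt_pos.2 (weight_pos a b ω h)).ne'
  have h2 : (√(weight a b ω h))⁻¹ * weight a b ω h = √(weight a b ω h) := by
    rw [inv_mul_eq_iff_eq_mul₀ h1, Real.mul_self_sqrt (weight_nonneg a b ω h)]
  exact_mod_cast h2

/-- The integral of kernel sections lies in `H(K)` by construction, and its values are those of `W`
applied to the character, namely `ω_h` times it; the normalisation leaves `√ω_h`. -/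
lemma basisVec_apply (hs : Summable fun h : Fin s → ℤ => weight a b ω h) (h : Fin s → ℤ)
    (x : Cube s) : basisVec a b ω h x = √(weight a b ω h) * cubeChar h x := by
  rw [basisVec, ← inner_kernelSection, inner_smul_right,
    ← integral_inner (integrable_cubeChar_smul_kernelSection hs h)]
  simp only [inner_smul_right, inner_kernelSection, kernelSection_apply]
  rw [integral_cubeChar_mul_kernel hs, ← mul_assoc, sqrt_weight_inv_mul]

lemma orthonormal_basisVec (hs : Summable fun h : Fin s → ℤ => weight a b ω h) :
    Orthonormal ℂ (basisVec (s := s) a b ω) := by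
  classical
  rw [orthonormal_iff_ite]
  intro g h
  conv_lhs => rw [show basisVec a b ω h = ((√(weight a b ω h))⁻¹ : ℂ) •
    ∫ t, cubeChar h t • kernelSection a b ω t from rfl]
  rw [inner_smul_right, ← integral_inner (integrable_cubeChar_smul_kernelSection hs h)]
  have h1 (t) : inner ℂ (basisVec a b ω g) (cubeChar h t • kernelSection a b ω t) =
      √(weight a b ω g) * (star (cubeChar g t) * cubeChar h t) := by
    rw [inner_smul_right, inner_kernelSection_right, basisVec_apply hs]
    simp
    ring
  simp only [h1]
  rw [integral_const_mul, integral_star_cubeChar_mul]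
  split_ifs with hgh
  · subst hgh
    rw [mul_one]
    exact inv_mul_cancel₀ (by
      exact_mod_cast (Real.sqrt_pos.2 (weight_pos a b ω g)).ne')
  · simp

/-! ### Eigenvalues of the covariance operator. -/

lemma covariance_basisVec (hs : Summable fun h : Fin s → ℤ => weight a b ω h) (h : Fin s → ℤ)
    (x : Cube s) :
    covariance a b ω (basisVec a b ω h) x = (weight a b ω h : ℂ) * basisVec a b ω h x := by
  simp only [covariance, basisVec_apply hs, mul_assoc]
  rw [integral_const_mul, integral_cubeChar_mul_kernel hs]
  ring

/-- Evaluate the eigenvalue equation at a point where `|f|` is maximal and use the uniform bound on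
the kernel. -/
lemma eigenvalue_le_tsum_weight (hs : Summable fun h : Fin s → ℤ => weight a b ω h) {μ : ℝ}
    {f : Space a b ω s} (hf : f ≠ 0) (hμ : ∀ x, covariance a b ω f x = (μ : ℂ) * f x) :
    μ ≤ ∑' h : Fin s → ℤ, weight a b ω h := by
  obtain ⟨x, -, hx⟩ := isCompact_univ.exists_isMaxOn ⟨fun _ => 0, Set.mem_univ _⟩
    (Space.continuous hs f).norm.continuousOn
  have hmax : ∀ y, ‖f y‖ ≤ ‖f x‖ := fun y => hx (Set.mem_univ y)
  have hpos : 0 < ‖f x‖ := by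
    obtain ⟨y, hy⟩ : ∃ y, f y ≠ 0 := by
      by_contra! h0
      exact hf (RKHS.ext fun y => by simpa using h0 y)
    exact (norm_pos_iff.2 hy).trans_le (hmax y)
  have h1 : ‖covariance a b ω f x‖ ≤
      ‖f x‖ * (∑' h : Fin s → ℤ, weight a b ω h) * volume.real (Set.univ : Set (Cube s)) := by
    refine norm_integral_le_of_norm_le_const (ae_of_all _ fun t => ?_)
    rw [norm_mul]
    exact mul_le_mul (hmax t) (norm_kernel_le hs x t) (norm_nonneg _) (norm_nonneg _)
  rw [probReal_univ, mul_one, hμ, norm_mul, mul_comm, Complex.norm_real] at h1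
  exact (Real.le_norm_self μ).trans (le_of_mul_le_mul_left h1 hpos)

/-- Boundedness makes the `sSup` in `eigenvalue` a genuine supremum. The index is `n + 1` because
for index `0` the rank condition is void and every `t > 0` would qualify. -/
lemma bddAbove_eigenvalue_set (hs : Summable fun h : Fin s → ℤ => weight a b ω h) (n : ℕ) :
    BddAbove {t : ℝ | 0 < t ∧ ((n + 1 : ℕ) : Cardinal) ≤ Module.rank ℂ (eigenspaceGE a b ω s t)} := by
  refine ⟨∑' h : Fin s → ℤ, weight a b ω h, fun t ht => ?_⟩
  have hne : ∃ f : Space a b ω s, f ≠ 0 ∧ ∃ μ : ℝ, t ≤ μ ∧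
      ∀ x, covariance a b ω f x = (μ : ℂ) * f x := by
    by_contra! h0
    have hbot : eigenspaceGE a b ω s t = ⊥ := by
      rw [eigenspaceGE, Submodule.span_eq_bot]
      rintro f ⟨μ, hμ, hf⟩
      by_contra hf0
      obtain ⟨x, hx⟩ := h0 f hf0 μ hμ
      exact hx (hf x)
    have h2 := ht.2
    rw [hbot, rank_bot] at h2
    have : n + 1 ≤ 0 := by exact_mod_cast h2
    omega
  obtain ⟨f, hf, μ, hμ, h⟩ := hne
  exact hμ.trans (eigenvalue_le_tsum_weight hs hf h)

/-- The `n + 1` independent vectors `basisVec (e 0), …, basisVec (e n)` have eigenvalues at least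
`weight (e n)`. Only this inequality is needed, so completeness of the system never enters. -/
lemma weight_le_eigenvalue (hs : Summable fun h : Fin s → ℤ => weight a b ω h)
    {e : ℕ → Fin s → ℤ} (he : Function.Injective e) (hanti : Antitone fun k => weight a b ω (e k))
    (n : ℕ) : weight a b ω (e n) ≤ eigenvalue a b ω s (n + 1) := by
  refine le_csSup (bddAbove_eigenvalue_set hs n) ⟨weight_pos a b ω _, ?_⟩
  let v : Fin (n + 1) → eigenspaceGE a b ω s (weight a b ω (e n)) := fun i =>
    ⟨basisVec a b ω (e i), Submodule.subset_span
      ⟨weight a b ω (e i), hanti (Nat.lt_succ_iff.1 i.2), covariance_basisVec hs _⟩⟩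
  have hv : LinearIndependent ℂ v := by
    refine LinearIndependent.of_comp (Submodule.subtype _) ?_
    exact (orthonormal_basisVec hs).linearIndependent.comp (fun i : Fin (n + 1) => e i)
      fun i j hij => Fin.ext (he hij)
  simpa using hv.cardinal_le_rank

/-- The orthogonal projection onto the span of finitely many basis vectors, pointwise. -/
lemma norm_sub_sum_basisVec_le (hs : Summable fun h : Fin s → ℤ => weight a b ω h)
    (F : Finset (Fin s → ℤ)) (f : Space a b ω s) (x : Cube s) :
    ‖f x - ∑ h ∈ F, inner ℂ (basisVec a b ω h) f * basisVec a b ω h x‖ ≤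
      √(∑' h : Fin s → ℤ, weight a b ω h - ∑ h ∈ F, weight a b ω h) * ‖f‖ := by
  -- The error at `x` is the inner product of `f` with the part of the kernel section orthogonal to
  -- the span, whose norm follows from Pythagoras.
  have h1 : f x - ∑ h ∈ F, inner ℂ (basisVec a b ω h) f * basisVec a b ω h x =
      inner ℂ (kernelSection a b ω x - ∑ h ∈ F,
        inner ℂ (basisVec a b ω h) (kernelSection a b ω x) • basisVec a b ω h) f := by
    rw [inner_sub_left, inner_kernelSection, sum_inner]
    congr 1
    refine Finset.sum_congr rfl fun h _ => ?_
    rw [inner_smul_left, inner_conj_symm, inner_kernelSection, mul_comm]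
  have h2 := norm_sq_sub_sum_inner (orthonormal_basisVec hs) F (kernelSection a b ω x)
  have h3 (h : Fin s → ℤ) :
      ‖inner ℂ (basisVec a b ω h) (kernelSection a b ω x)‖ ^ 2 = weight a b ω h := by
    rw [inner_kernelSection_right, basisVec_apply hs, norm_star, norm_mul, norm_cubeChar, mul_one,
      Complex.norm_real, Real.norm_of_nonneg (Real.sqrt_nonneg _),
      Real.sq_sqrt (weight_nonneg a b ω h)]
  simp only [h3, norm_kernelSection_sq] at h2
  rw [h1, ← h2, Real.sqrt_sq (norm_nonneg _)]
  exact norm_inner_le_norm _ _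

lemma tsum_weight_sub_sum_le (hs : Summable fun h : Fin s → ℤ => weight a b ω h)
    (e : ℕ ≃ (Fin s → ℤ))
    (hanti : Antitone fun k => weight a b ω (e k)) {β M : ℝ} (hβ : 1 / 2 < β)
    (hdecay : ∀ n : ℕ, 1 ≤ n → eigenvalue a b ω s n ≤ M ^ 2 / (n : ℝ) ^ (2 * β))
    {n : ℕ} (hn : 1 ≤ n) :
    ∑' h : Fin s → ℤ, weight a b ω h - ∑ i : Fin n, weight a b ω (e i) ≤
      M ^ 2 * (1 / ((2 * β - 1) * (n : ℝ) ^ (2 * β - 1))) := by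
  have hs' : Summable fun k => weight a b ω (e k) :=
    (e.summable_iff (f := weight a b ω)).2 hs
  have hsplit := hs'.sum_add_tsum_nat_add n
  rw [e.tsum_eq (weight a b ω)] at hsplit
  rw [Fin.sum_univ_eq_sum_range (fun i => weight a b ω (e i)) n, ← hsplit, add_sub_cancel_left]
  refine Real.tsum_le_of_sum_range_le (fun _ => weight_nonneg a b ω _) fun N => ?_
  calc ∑ i ∈ Finset.range N, weight a b ω (e (i + n))
      ≤ ∑ i ∈ Finset.range N, M ^ 2 * (1 / ((n + i + 1 : ℕ) : ℝ) ^ (2 * β)) := by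
        refine Finset.sum_le_sum fun i _ => ?_
        rw [mul_one_div, add_comm i n]
        exact (weight_le_eigenvalue hs e.injective hanti _).trans (hdecay _ (by omega))
    _ ≤ _ := by
        rw [← Finset.mul_sum]
        exact mul_le_mul_of_nonneg_left (sum_range_one_div_rpow_le (by linarith) hn N) (sq_nonneg M)

/-- The uniform error of the projection onto the span of the first `n` basis vectors. -/
lemma norm_sub_sum_le (hs : Summable fun h : Fin s → ℤ => weight a b ω h)
    (e : ℕ ≃ (Fin s → ℤ))
    (hanti : Antitone fun k => weight a b ω (e k)) {β M : ℝ} (hβ : 1 / 2 < β) (hM : 0 < M)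
    (hdecay : ∀ n : ℕ, 1 ≤ n → eigenvalue a b ω s n ≤ M ^ 2 / (n : ℝ) ^ (2 * β))
    {n : ℕ} (hn : 1 ≤ n) {f : Space a b ω s} (hf : ‖f‖ ≤ 1) (x : Cube s) :
    ‖f x - ∑ i : Fin n, inner ℂ (basisVec a b ω (e i)) f * basisVec a b ω (e i) x‖ ≤
      M / √(2 * β - 1) * (1 / (n : ℝ) ^ (β - 1 / 2)) := by
  have h1 := norm_sub_sum_basisVec_le hs
    (Finset.univ.map ⟨fun i : Fin n => e i, e.injective.comp Fin.val_injective⟩) f x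
  simp only [Finset.sum_map, Function.Embedding.coeFn_mk] at h1
  refine h1.trans ((mul_le_of_le_one_right (Real.sqrt_nonneg _) hf).trans ?_)
  refine (Real.sqrt_le_sqrt (tsum_weight_sub_sum_le hs e hanti hβ hdecay hn)).trans (le_of_eq ?_)
  have h2 : (n : ℝ) ^ (2 * β - 1) = ((n : ℝ) ^ (β - 1 / 2)) ^ 2 := by
    rw [← Real.rpow_natCast, ← Real.rpow_mul (Nat.cast_nonneg n)]
    congr 1
    push_cast
    ring
  rw [h2, Real.sqrt_mul (sq_nonneg M), Real.sqrt_sq hM.le, one_div,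
    Real.sqrt_inv, Real.sqrt_mul (by linarith), Real.sqrt_sq (by positivity), mul_inv]
  ring

/-! ### Bounds for the minimal errors. -/

lemma minimalError_le {Λ : Set (Space a b ω s →L[ℂ] ℂ)} {n : ℕ} {φ : Fin n → Cube s → ℂ}
    (hφ : ∀ k, Continuous (φ k)) {L : Fin n → Space a b ω s →L[ℂ] ℂ} (hL : ∀ k, L k ∈ Λ) {c : ℝ}
    (h : ∀ f : Space a b ω s, ‖f‖ ≤ 1 → ∀ x, ‖f x - ∑ k, φ k x * L k f‖ ≤ c) :
    minimalError Λ n ≤ ENNReal.ofReal c := by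
  have hmem (k) : MemLp (φ k) ∞ (volume : Measure (Cube s)) :=
    (hφ k).memLp_top_of_hasCompactSupport (HasCompactSupport.of_compactSpace _) _
  have hle : minimalError Λ n ≤ worstCaseError (fun k => (hmem k).toLp (φ k)) L :=
    iInf_le_of_le (fun k => (hmem k).toLp (φ k)) (iInf_le_of_le L (iInf_le _ hL))
  refine hle.trans ?_
  refine iSup_le fun f => iSup_le fun hf => ?_
  rw [eLpNorm_exponent_top]
  refine eLpNormEssSup_le_of_ae_bound ?_
  filter_upwards [ae_all_iff.2 fun k => (hmem k).coeFn_toLp] with x hx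
  simp only [hx]
  exact h f hf x

lemma one_le_C {x : ℝ} (hx : 1 / 2 < x) : 1 ≤ C x := by
  have h1 : 1 ≤ (2 : ℝ) ^ (2 * x * (2 * x + 1) + x - 1 / 2) :=
    Real.one_le_rpow one_le_two (by nlinarith)
  have h2 : 1 ≤ ((2 * x + 1) / (2 * x - 1)) ^ (1 / 2 : ℝ) :=
    Real.one_le_rpow ((one_le_div (by linarith)).2 (by linarith)) (by norm_num)
  have h3 : 1 ≤ (1 + 1 / (2 * x)) ^ x :=
    Real.one_le_rpow (le_add_of_nonneg_right (by positivity)) (by linarith)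
  exact one_le_mul_of_one_le_of_one_le (one_le_mul_of_one_le_of_one_le h1 h2) h3

lemma linearIndependent_coe_basisVec (hs : Summable fun h : Fin s → ℤ => weight a b ω h) :
    LinearIndependent ℂ fun h : Fin s → ℤ => (basisVec a b ω h : Cube s → ℂ) := by
  refine (orthonormal_basisVec hs).linearIndependent.map'
    (RKHS.coeCLM (H := Space a b ω s) ℂ : Space a b ω s →ₗ[ℂ] Cube s → ℂ) ?_
  exact LinearMap.ker_eq_bot.2 RKHS.coeCLM_injective

lemma minimalError_all_le (hs : Summable fun h : Fin s → ℤ => weight a b ω h)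
    (e : ℕ ≃ (Fin s → ℤ)) (hanti : Antitone fun k => weight a b ω (e k)) {β M : ℝ}
    (hβ : 1 / 2 < β) (hM : 0 < M)
    (hdecay : ∀ n : ℕ, 1 ≤ n → eigenvalue a b ω s n ≤ M ^ 2 / (n : ℝ) ^ (2 * β))
    {n : ℕ} (hn : 1 ≤ n) :
    minimalError (LambdaAll a b ω s) n ≤
      ENNReal.ofReal (M / √(2 * β - 1) * (1 / (n : ℝ) ^ (β - 1 / 2))) := by
  refine minimalError_le (φ := fun i : Fin n => basisVec a b ω (e i))
    (L := fun i => innerSL ℂ (basisVec a b ω (e i))) (fun i => Space.continuous hs _)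
    (fun _ => Set.mem_univ _) fun f hf x => ?_
  simpa only [innerSL_apply_apply, mul_comm] using norm_sub_sum_le hs e hanti hβ hM hdecay hn hf x

/-- Lebesgue's argument: interpolation reproduces the projection `q` of `f`, so its error is that of
`f - q`, and the `n` Lagrange functions are bounded by `1`. -/
lemma minimalError_std_le (hs : Summable fun h : Fin s → ℤ => weight a b ω h)
    (e : ℕ ≃ (Fin s → ℤ)) (hanti : Antitone fun k => weight a b ω (e k)) {β M : ℝ}
    (hβ : 1 / 2 < β) (hM : 0 < M)
    (hdecay : ∀ n : ℕ, 1 ≤ n → eigenvalue a b ω s n ≤ M ^ 2 / (n : ℝ) ^ (2 * β))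
    {n : ℕ} (hn : 1 ≤ n) :
    minimalError (LambdaStd a b ω s) n ≤
      ENNReal.ofReal ((1 + n) * (M / √(2 * β - 1) * (1 / (n : ℝ) ^ (β - 1 / 2)))) := by
  obtain ⟨p, l, hlc, hl, hint⟩ := exists_lagrange_le_one
    ((linearIndependent_coe_basisVec hs).comp (fun i : Fin n => e i)
      (e.injective.comp Fin.val_injective)) fun i => Space.continuous hs _
  simp only [Function.comp_apply] at hint
  refine minimalError_le (L := fun j => innerSL ℂ (kernelSection a b ω (p j))) hlc
    (fun j => Set.mem_ofPred.2 ⟨p j, fun f => inner_kernelSection _ f⟩) fun f hf x => ?_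
  simp only [innerSL_apply_apply, inner_kernelSection]
  set ε := M / √(2 * β - 1) * (1 / (n : ℝ) ^ (β - 1 / 2))
  let q : Cube s → ℂ := fun y =>
    ∑ i : Fin n, inner ℂ (basisVec a b ω (e i)) f * basisVec a b ω (e i) y
  have hq (y) : ‖f y - q y‖ ≤ ε := norm_sub_sum_le hs e hanti hβ hM hdecay hn hf y
  have hlq : ∑ j, l j x * q (p j) = q x := by
    simp only [q, Finset.mul_sum]
    rw [Finset.sum_comm]
    refine Finset.sum_congr rfl fun i _ => ?_
    rw [← hint i x, Finset.mul_sum]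
    exact Finset.sum_congr rfl fun j _ => mul_left_comm _ _ _
  have hsplit : f x - ∑ j, l j x * f (p j) =
      (f x - q x) - ∑ j, l j x * (f (p j) - q (p j)) := by
    simp only [mul_sub, Finset.sum_sub_distrib, hlq]
    ring
  have hsum : ‖∑ j, l j x * (f (p j) - q (p j))‖ ≤ n * ε := by
    refine (norm_sum_le_of_le (f := fun j => l j x * (f (p j) - q (p j))) (n := fun _ => ε)
      Finset.univ fun j _ => ?_).trans (by simp)
    rw [norm_mul]
    exact (mul_le_of_le_one_left (norm_nonneg _) (hl j x)).trans (hq _)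
  rw [hsplit, add_mul, one_mul]
  exact (norm_sub_le _ _).trans (add_le_add (hq x) hsum)

end Korobov

end

theorem lemma3 (a b : ℕ → ℝ) (ω : Set.Ioo (0 : ℝ) 1)
    (ha_pos : ∀ j, 0 < a j) (ha : 0 < ⨅ j, a j) (ha_mono : Monotone a)
    (hb_pos : ∀ j, 0 < b j) (hb : 0 < ⨅ j, b j)
    (s : ℕ) (hs : 1 ≤ s) (β M : ℝ) (hβ : 0 < β) (hM : 0 < M)
    (hdecay : ∀ n : ℕ, 1 ≤ n → Korobov.eigenvalue a b ω s n ≤ M ^ 2 / (n : ℝ) ^ (2 * β)) :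
    (1 / 2 < β → ∀ n : ℕ, 1 ≤ n →
      Korobov.minimalError (Korobov.LambdaAll a b ω s) n ≤
        ENNReal.ofReal (M / √(2 * β - 1) * (1 / (n : ℝ) ^ (β - 1 / 2)))) ∧
    (3 / 2 < β → ∀ n : ℕ, 1 ≤ n →
      Korobov.minimalError (Korobov.LambdaStd a b ω s) n ≤
        ENNReal.ofReal (M * (√2 / 2 + Korobov.C β) * (1 / (n : ℝ) ^ (β - 3 / 2)))) := by
  have : Nonempty (Fin s) := ⟨⟨0, hs⟩⟩
  have hsum := Korobov.summable_weight (ω := ω) (s := s) ha_pos hb_pos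
  obtain ⟨e, he⟩ := Korobov.exists_equiv_nat_antitone (Korobov.weight_pos (s := s) a b ω) hsum
  refine ⟨fun h n hn => Korobov.minimalError_all_le hsum e he h hM hdecay hn, fun h n hn => ?_⟩
  refine (Korobov.minimalError_std_le hsum e he (by linarith) hM hdecay hn).trans
    (ENNReal.ofReal_le_ofReal ?_)
  have hn1 : (1 : ℝ) ≤ n := by exact_mod_cast hn
  have hn0 : (0 : ℝ) < n := by linarith
  have hpow : (n : ℝ) ^ (β - 1 / 2) = n * (n : ℝ) ^ (β - 3 / 2) := by
    rw [← Real.rpow_one_add' hn0.le (by linarith)]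
    congr 1
    ring
  have hP : 0 < (n : ℝ) ^ (β - 3 / 2) := by positivity
  have h2 : 0 < √2 := by positivity
  have hsq : √2 * √2 = 2 := Real.mul_self_sqrt zero_le_two
  have hle : √2 ≤ √(2 * β - 1) := Real.sqrt_le_sqrt (by linarith)
  have hC := Korobov.one_le_C (show 1 / 2 < β by linarith)
  -- The numerator `2` comes from `1 + n ≤ 2n`. As `β > 3/2`, the left side is at most `√2`, and `√2
  -- / 2 ≤ 1 ≤ C β`.
  have hconst : 2 / √(2 * β - 1) ≤ √2 / 2 + Korobov.C β := by
    rw [div_le_iff₀ (h2.trans_le hle)]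
    have h3 : √2 ≤ √2 / 2 + Korobov.C β := by nlinarith
    exact hsq.symm.le.trans (mul_le_mul h3 hle h2.le (h2.le.trans h3))
  calc (1 + (n : ℝ)) * (M / √(2 * β - 1) * (1 / (n : ℝ) ^ (β - 1 / 2)))
      ≤ (2 * n) * (M / √(2 * β - 1) * (1 / (n : ℝ) ^ (β - 1 / 2))) :=
        mul_le_mul_of_nonneg_right (by linarith) (by positivity)
    _ = M * (2 / √(2 * β - 1)) * (1 / (n : ℝ) ^ (β - 3 / 2)) := by
        rw [hpow]
        field_simp
    _ ≤ _ := by gcongr
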